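/- Let $R$ be a commutative integral domain and let $M$ be an $R$-module with torsion submodule $T(M)$. Call a module virtually regular if each of its cyclic submodules is isomorphic to a direct summand of the module. (i) If $M$ is virtually regular, then $T(M)$ and $M/T(M)$ are virtually regular. (ii) Suppose that $R$ is an almost maximal Prüfer domain; that is, the localization of $R$ at every maximal ideal is a valuation domain, and every system of congruences $x \equiv r_k \pmod{L_k}$ $(k \in K)$, where $K$ is any index set, $r_k \in R$, and the $L_k$ are ideals of $R$ with $\bigcap_{k\in K} L_k \neq 0$, has a solution in $R$ whenever each of its finite subsystems has a solution in $R$. If $T(M)$ and $M/T(M)$ are virtually regular, then $M$ is virtually regular. -/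

import Mathlib

universe u v

/-- A module is virtually regular if every cyclic submodule is isomorphic to a direct summand. -/
def IsVirtuallyRegular (R : Type u) (M : Type v) [Ring R] [AddCommGroup M] [Module R M] : Prop :=
  ∀ N : Submodule R M, N.IsPrincipal →
    ∃ B C : Submodule R M, IsCompl B C ∧ Nonempty (N ≃ₗ[R] B)

/-- A domain is a Prüfer domain if its localizations at all maximal ideals are valuation
domains. -/
def IsPruferDomain (R : Type u) [CommRing R] [IsDomain R] : Prop :=
  ∀ (P : Ideal R) [P.IsMaximal], ValuationRing (Localization.AtPrime P)

/-- A commutative ring is almost maximal if every system of congruences `x ≡ r k (mod L k)`, with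
`L k` ideals having nonzero intersection, is solvable as soon as all of its finite subsystems
are solvable. -/
def IsAlmostMaximal (R : Type u) [CommRing R] : Prop :=
  ∀ (K : Type u) (L : K → Ideal R) (r : K → R), (⨅ k, L k) ≠ ⊥ →
    (∀ s : Finset K, ∃ x : R, ∀ k ∈ s, x - r k ∈ L k) →
    ∃ x : R, ∀ k, x - r k ∈ L k

/-! Virtual regularity means that every cyclic `Rx` is a retract of `M`. If `x` is not torsion, then
`Rx ≅ R`: maps from `M` to `R` kill torsion and maps out of `R` lift, so retractions pass between
`M` and `M/T(M)`. If `x` is torsion, a section of `Rx` lands in `T(M)`, which gives the rest of (i).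
For (ii), a retract `Rb ≅ Rx` of `T(M)` is relatively divisible in `M`, because `M/T(M)` is
torsion-free. It is a summand by `IsRelDivisible.exists_isCompl`: a submodule maximal among those
that keep `Rb` relatively divisible in the quotient is a complement. Enlarging it by `m - n`
requires `n` in `Rb` to satisfy every congruence that `m` satisfies. Almost maximality reduces this
to finite systems, localization to valuation rings, and uniseriality to pairs. -/

/-- A submodule is relatively divisible if `N ∩ s • M = s • N` for all scalars `s`. -/
def IsRelDivisible {R : Type u} {M : Type v} [CommRing R] [AddCommGroup M] [Module R M]
    (N : Submodule R M) : Prop :=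
  ∀ x ∈ N, ∀ (s : R) (m : M), x = s • m → ∃ n ∈ N, x = s • n

/-! ### Congruences over a valuation ring -/

section Valuation

variable {V : Type u} [CommRing V] [IsDomain V] [ValuationRing V]
  {M : Type v} [AddCommGroup M] [Module V M]

theorem IsRelDivisible.exists_solution_single {N : Submodule V M} (hN : IsRelDivisible N) (m : M)
    (r s : V) (c : M) (hc : c ∈ N) (h : ∃ y, r • m - c = s • y) :
    ∃ n ∈ N, ∃ y ∈ N, r • n - c = s • y := by
  obtain ⟨y, hy⟩ := h
  rcases ValuationRing.dvd_total r s with ⟨t, rfl⟩ | ⟨t, rfl⟩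
  · obtain ⟨d, hd, e⟩ := hN c hc r (m - t • y) (by
      rw [smul_sub, smul_smul, ← hy]; abel)
    exact ⟨d, hd, 0, N.zero_mem, by rw [e]; simp⟩
  · obtain ⟨d, hd, e⟩ := hN c hc s (t • m - y) (by
      rw [smul_sub, smul_smul, ← hy]; abel)
    exact ⟨0, N.zero_mem, -d, N.neg_mem hd, by rw [e]; simp⟩

/-- Relative divisibility gives `c i = r i • d i`. Eliminating `m` puts the larger of the `r i`,
times `d₁ - d₂`, in a multiple of `M`, hence in the same multiple of `N`. -/
theorem IsRelDivisible.exists_solution_pair_aux {N : Submodule V M} (hN : IsRelDivisible N)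
    (m : M) (r₁ r₂ t₁ t₂ : V) (c₁ c₂ : M) (hc₁ : c₁ ∈ N) (hc₂ : c₂ ∈ N)
    (h₁ : ∃ y, r₁ • m - c₁ = (r₁ * t₁) • y) (h₂ : ∃ y, r₂ • m - c₂ = (r₂ * t₂) • y)
    (ht : t₁ ∣ t₂) :
    ∃ n ∈ N, (∃ y ∈ N, r₁ • n - c₁ = (r₁ * t₁) • y) ∧ ∃ y ∈ N, r₂ • n - c₂ = (r₂ * t₂) • y := by
  obtain ⟨y₁, h₁⟩ := h₁
  obtain ⟨y₂, h₂⟩ := h₂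
  obtain ⟨w, rfl⟩ := ht
  obtain ⟨d₁, hd₁, rfl⟩ := hN c₁ hc₁ r₁ (m - t₁ • y₁) (by
    rw [smul_sub, smul_smul, ← h₁]; abel)
  obtain ⟨d₂, hd₂, rfl⟩ := hN c₂ hc₂ r₂ (m - (t₁ * w) • y₂) (by
    rw [smul_sub, smul_smul, ← h₂]; abel)
  rcases ValuationRing.dvd_total r₁ r₂ with ⟨q, rfl⟩ | ⟨q, rfl⟩
  · obtain ⟨e, he, h⟩ := hN ((r₁ * q) • (d₁ - d₂)) (N.smul_mem _ (N.sub_mem hd₁ hd₂))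
      (r₁ * q * t₁) (w • y₂ - y₁) (by
        linear_combination (norm := module) h₂ - q • h₁)
    refine ⟨d₁ - t₁ • e, N.sub_mem hd₁ (N.smul_mem _ he), ⟨-e, N.neg_mem he, ?_⟩,
      ⟨0, N.zero_mem, ?_⟩⟩
    · module
    · linear_combination (norm := module) h
  · obtain ⟨e, he, h⟩ := hN ((r₂ * q) • (d₁ - d₂)) (N.smul_mem _ (N.sub_mem hd₁ hd₂))
      (r₂ * q * t₁) (w • y₂ - y₁) (by
        linear_combination (norm := module) q • h₂ - h₁)
    refine ⟨d₂, hd₂, ⟨-e, N.neg_mem he, ?_⟩, ⟨0, N.zero_mem, by simp⟩⟩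
    linear_combination (norm := module) -h

theorem IsRelDivisible.exists_solution_pair {N : Submodule V M} (hN : IsRelDivisible N)
    (m : M) (r₁ r₂ s₁ s₂ : V) (c₁ c₂ : M) (hc₁ : c₁ ∈ N) (hc₂ : c₂ ∈ N)
    (h₁ : ∃ y, r₁ • m - c₁ = s₁ • y) (h₂ : ∃ y, r₂ • m - c₂ = s₂ • y) :
    ∃ n ∈ N, (∃ y ∈ N, r₁ • n - c₁ = s₁ • y) ∧ ∃ y ∈ N, r₂ • n - c₂ = s₂ • y := by
  -- If `s ∣ r`, then `c` lies in `s • N`, so the congruence holds for every `n`.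
  have trivial_of_dvd : ∀ (r s : V) (c : M), c ∈ N → (∃ y, r • m - c = s • y) → s ∣ r →
      ∀ n ∈ N, ∃ y ∈ N, r • n - c = s • y := by
    rintro r s c hc ⟨y, hy⟩ ⟨t, rfl⟩ n hn
    obtain ⟨d, hd, rfl⟩ := hN c hc s (t • m - y) (by
      rw [smul_sub, smul_smul, ← hy]; abel)
    exact ⟨t • n - d, N.sub_mem (N.smul_mem _ hn) hd, by module⟩
  rcases ValuationRing.dvd_total r₁ s₁ with d₁ | d₁
  · rcases ValuationRing.dvd_total r₂ s₂ with d₂ | d₂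
    · obtain ⟨t₁, rfl⟩ := d₁
      obtain ⟨t₂, rfl⟩ := d₂
      rcases ValuationRing.dvd_total t₁ t₂ with ht | ht
      · exact hN.exists_solution_pair_aux m r₁ r₂ t₁ t₂ c₁ c₂ hc₁ hc₂ h₁ h₂ ht
      · obtain ⟨n, hn, a, b⟩ :=
          hN.exists_solution_pair_aux m r₂ r₁ t₂ t₁ c₂ c₁ hc₂ hc₁ h₂ h₁ ht
        exact ⟨n, hn, b, a⟩
    · obtain ⟨n, hn, h⟩ := hN.exists_solution_single m r₁ s₁ c₁ hc₁ h₁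
      exact ⟨n, hn, h, trivial_of_dvd r₂ s₂ c₂ hc₂ h₂ d₂ n hn⟩
  · obtain ⟨n, hn, h⟩ := hN.exists_solution_single m r₂ s₂ c₂ hc₂ h₂
    exact ⟨n, hn, trivial_of_dvd r₁ s₁ c₁ hc₁ h₁ d₁ n hn, h⟩

/-- Cyclic modules over a valuation ring are uniserial. -/
theorem ValuationRing.le_total_of_le_span_singleton (b : M) {A B : Submodule V M}
    (hA : A ≤ Submodule.span V {b}) (hB : B ≤ Submodule.span V {b}) : A ≤ B ∨ B ≤ A := by
  rw [← LinearMap.range_toSpanSingleton] at hA hB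
  have key := (ValuationRing.iff_ideal_total.mp ‹ValuationRing V›).total
    (A.comap (LinearMap.toSpanSingleton V M b)) (B.comap (LinearMap.toSpanSingleton V M b))
  rw [← Submodule.map_comap_eq_self hA, ← Submodule.map_comap_eq_self hB]
  exact key.imp (Submodule.map_mono ·) (Submodule.map_mono ·)

theorem IsRelDivisible.exists_solution_of_valuationRing {ι : Type*} {b : M}
    (hN : IsRelDivisible (Submodule.span V {b})) (m : M) (F : Finset ι) (r s : ι → V) (c : ι → M)
    (hc : ∀ i ∈ F, c i ∈ Submodule.span V {b}) (h : ∀ i ∈ F, ∃ y, r i • m - c i = s i • y) :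
    ∃ n ∈ Submodule.span V {b}, ∀ i ∈ F, ∃ y ∈ Submodule.span V {b},
      r i • n - c i = s i • y := by
  classical
  set N := Submodule.span V {b} with hNdef
  -- Solutions of the homogeneous congruence; the full solution set is a coset of `L i`.
  let L : ι → Submodule V M := fun i =>
    N ⊓ (N.map (LinearMap.lsmul V M (s i))).comap (LinearMap.lsmul V M (r i))
  have htot : ∀ i j, L i ≤ L j ∨ L j ≤ L i := fun i j =>
    ValuationRing.le_total_of_le_span_singleton b inf_le_left inf_le_left
  rcases F.eq_empty_or_nonempty with rfl | hF
  · exact ⟨0, N.zero_mem, by simp⟩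
  obtain ⟨i, hi, hmin⟩ : ∃ i ∈ F, ∀ j ∈ F, L i ≤ L j := by
    obtain ⟨i, hi, hmin⟩ := F.exists_minimalFor L hF
    exact ⟨i, hi, fun j hj => (htot i j).elim id fun hle => hmin hj hle⟩
  obtain ⟨x, hx, y, hy, hxy⟩ := hN.exists_solution_single m (r i) (s i) (c i) (hc i hi) (h i hi)
  -- A solution for the smallest `L i` differs from a common solution of `i` and `j` by an element
  -- of `L i ≤ L j`, so it also solves `j`.
  refine ⟨x, hx, fun j hj => ?_⟩
  obtain ⟨z, hz, ⟨y₁, hy₁, e₁⟩, y₂, hy₂, e₂⟩ := hN.exists_solution_pair m (r i) (r j) (s i) (s j)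
    (c i) (c j) (hc i hi) (hc j hj) (h i hi) (h j hj)
  have hmem : x - z ∈ L i := by
    refine ⟨N.sub_mem hx hz, y - y₁, N.sub_mem hy hy₁, ?_⟩
    simp only [LinearMap.lsmul_apply]
    linear_combination (norm := module) e₁ - hxy
  obtain ⟨-, w, hw, e⟩ := hmin j hj hmem
  simp only [LinearMap.lsmul_apply] at e
  exact ⟨y₂ + w, N.add_mem hy₂ hw, by linear_combination (norm := module) e₂ - e⟩

end Valuation

/-! ### Patching over a Prüfer domain, and splitting -/

section Prufer

variable {R : Type u} [CommRing R] {M : Type v} [AddCommGroup M] [Module R M]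

theorem IsRelDivisible.span_mk {b : M} (hN : IsRelDivisible (Submodule.span R {b}))
    (P : Ideal R) [P.IsPrime] :
    IsRelDivisible (Submodule.span (Localization.AtPrime P)
      {LocalizedModule.mkLinearMap P.primeCompl M b}) := by
  intro x hx s y hxy
  obtain ⟨a, rfl⟩ := Submodule.mem_span_singleton.mp hx
  induction a using Localization.induction_on with | _ a
  induction s using Localization.induction_on with | _ s
  induction y using LocalizedModule.induction_on with | _ y w
  obtain ⟨a, u⟩ := a
  obtain ⟨s, v⟩ := s
  simp only [LocalizedModule.mkLinearMap_apply, LocalizedModule.mk_smul_mk] at hxy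
  obtain ⟨t, ht⟩ := LocalizedModule.mk_eq.mp hxy
  simp only [Submonoid.smul_def, Submonoid.coe_mul, smul_smul, mul_one] at ht
  obtain ⟨n, hn, e⟩ := hN _ (Submodule.smul_mem _ _ (Submodule.mem_span_singleton_self b)) s
    ((t * u : R) • y) (ht.trans (by rw [smul_smul]; congr 1; ring))
  obtain ⟨k, rfl⟩ := Submodule.mem_span_singleton.mp hn
  refine ⟨Localization.mk k (t * w * u) • LocalizedModule.mkLinearMap P.primeCompl M b,
    Submodule.smul_mem _ _ (Submodule.mem_span_singleton_self _), ?_⟩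
  simp only [LocalizedModule.mkLinearMap_apply, LocalizedModule.mk_smul_mk]
  refine LocalizedModule.mk_eq.mpr ⟨1, ?_⟩
  simp only [Submonoid.smul_def, Submonoid.coe_mul, smul_smul, mul_one, Submonoid.coe_one,
    one_mul] at e ⊢
  linear_combination (norm := module) (u : R) • e

variable [IsDomain R]

theorem IsRelDivisible.exists_local_solution {ι : Type*} {b : M}
    (hN : IsRelDivisible (Submodule.span R {b})) (P : Ideal R) [P.IsPrime]
    [ValuationRing (Localization.AtPrime P)] (m : M) (F : Finset ι)
    (r s : ι → R) (c : ι → M)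
    (hc : ∀ i ∈ F, c i ∈ Submodule.span R {b}) (h : ∀ i ∈ F, ∃ y, r i • m - c i = s i • y) :
    ∃ u ∉ P, ∃ n ∈ Submodule.span R {b}, ∀ i ∈ F, ∃ y ∈ Submodule.span R {b},
      r i • n - u • c i = s i • y := by
  classical
  let f := LocalizedModule.mkLinearMap P.primeCompl M
  obtain ⟨n, hn, H⟩ := (hN.span_mk P).exists_solution_of_valuationRing (f m) F
    (fun i => algebraMap R _ (r i)) (fun i => algebraMap R _ (s i)) (fun i => f (c i))
    (fun i hi => by
      obtain ⟨a, ha⟩ := Submodule.mem_span_singleton.mp (hc i hi)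
      refine Submodule.mem_span_singleton.mpr ⟨algebraMap R _ a, ?_⟩
      rw [algebraMap_smul, ← ha, map_smul])
    (fun i hi => by
      obtain ⟨y, hy⟩ := h i hi
      refine ⟨f y, ?_⟩
      simp only [algebraMap_smul, ← map_smul, ← map_sub, hy])
  obtain ⟨a, rfl⟩ := Submodule.mem_span_singleton.mp hn
  induction a using Localization.induction_on with | _ a
  obtain ⟨a, v⟩ := a
  have key : ∀ i ∈ F, ∃ t ∉ P, ∃ y ∈ Submodule.span R {b},
      t • (r i • a • b - (v : R) • c i) = s i • y := by
    intro i hi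
    obtain ⟨y, hy, e⟩ := H i hi
    obtain ⟨k, rfl⟩ := Submodule.mem_span_singleton.mp hy
    induction k using Localization.induction_on with | _ k
    obtain ⟨k, w⟩ := k
    simp only [f, LocalizedModule.mkLinearMap_apply, LocalizedModule.mk_smul_mk, algebraMap_smul,
      LocalizedModule.smul'_mk, sub_eq_iff_eq_add, LocalizedModule.mk_add_mk] at e
    obtain ⟨t, ht⟩ := LocalizedModule.mk_eq.mp e
    simp only [Submonoid.smul_def, mul_one, one_smul] at ht
    refine ⟨t * w, (t * w).2, (t * v * k : R) • b,
      Submodule.smul_mem _ _ (Submodule.mem_span_singleton_self b), ?_⟩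
    linear_combination (norm := module) ht
  choose! t ht y hy e using key
  have hprod : ∏ i ∈ F, t i ∉ P := by
    rw [Ideal.IsPrime.prod_mem_iff]
    rintro ⟨i, hi, hti⟩
    exact ht i hi hti
  refine ⟨(∏ i ∈ F, t i) * v, P.primeCompl.mul_mem hprod v.2, ((∏ i ∈ F, t i) * a) • b,
    Submodule.smul_mem _ _ (Submodule.mem_span_singleton_self b), fun i hi => ?_⟩
  obtain ⟨q, hq⟩ := Finset.dvd_prod_of_mem t hi
  refine ⟨q • y i, Submodule.smul_mem _ _ (hy i hi), ?_⟩
  rw [hq]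
  linear_combination (norm := module) q • e i hi

theorem IsRelDivisible.exists_solution {ι : Type*} {b : M} (hR : IsPruferDomain R)
    (hN : IsRelDivisible (Submodule.span R {b})) (m : M) (F : Finset ι) (r s : ι → R) (c : ι → M)
    (hc : ∀ i ∈ F, c i ∈ Submodule.span R {b}) (h : ∀ i ∈ F, ∃ y, r i • m - c i = s i • y) :
    ∃ n ∈ Submodule.span R {b}, ∀ i ∈ F, ∃ y ∈ Submodule.span R {b},
      r i • n - c i = s i • y := by
  -- The multipliers `u` for which the system scaled by `u` is solvable; local solutions keep `J`
  -- out of every maximal ideal.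
  let J : Ideal R :=
    { carrier := {u | ∃ n ∈ Submodule.span R {b}, ∀ i ∈ F, ∃ y ∈ Submodule.span R {b},
        r i • n - u • c i = s i • y}
      zero_mem' := ⟨0, zero_mem _, fun i _ => ⟨0, zero_mem _, by simp⟩⟩
      add_mem' := by
        rintro u u' ⟨n, hn, H⟩ ⟨n', hn', H'⟩
        refine ⟨n + n', add_mem hn hn', fun i hi => ?_⟩
        obtain ⟨y, hy, e⟩ := H i hi
        obtain ⟨y', hy', e'⟩ := H' i hi
        exact ⟨y + y', add_mem hy hy', by linear_combination (norm := module) e + e'⟩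
      smul_mem' := by
        rintro a u ⟨n, hn, H⟩
        refine ⟨a • n, Submodule.smul_mem _ _ hn, fun i hi => ?_⟩
        obtain ⟨y, hy, e⟩ := H i hi
        refine ⟨a • y, Submodule.smul_mem _ _ hy, ?_⟩
        rw [smul_eq_mul]
        linear_combination (norm := module) a • e }
  have hJ : J = ⊤ := by
    by_contra hne
    obtain ⟨P, hP, hle⟩ := Ideal.exists_le_maximal J hne
    have := hR P
    obtain ⟨u, hu, hsol⟩ := hN.exists_local_solution P m F r s c hc h
    exact hu (hle hsol)
  obtain ⟨n, hn, H⟩ : (1 : R) ∈ J := hJ ▸ Submodule.mem_top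
  exact ⟨n, hn, by simpa only [one_smul] using H⟩

theorem IsRelDivisible.exists_solution_of_isAlmostMaximal {b : M} (hR : IsPruferDomain R)
    (hR' : IsAlmostMaximal R) (hb : ∃ a : R, a ≠ 0 ∧ a • b = 0)
    (hN : IsRelDivisible (Submodule.span R {b})) (m : M) :
    ∃ n ∈ Submodule.span R {b}, ∀ c ∈ Submodule.span R {b}, ∀ (r s : R) (y : M),
      r • m - c = s • y → ∃ z ∈ Submodule.span R {b}, r • n - c = s • z := by
  set N := Submodule.span R {b} with hNdef
  -- Keeping `y` existential leaves the index type in the universe of `R`, as `IsAlmostMaximal`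
  -- demands.
  let K : Type u := {q : R × R × R // ∃ y, q.1 • m - q.2.2 • b = q.2.1 • y}
  have hfin : ∀ F : Finset K, ∃ x : R, ∀ k ∈ F, ∃ z ∈ N,
      k.1.1 • x • b - k.1.2.2 • b = k.1.2.1 • z := by
    intro F
    obtain ⟨n, hn, H⟩ := hN.exists_solution hR m F (fun k => k.1.1) (fun k => k.1.2.1)
      (fun k => k.1.2.2 • b) (fun k _ => N.smul_mem _ (Submodule.mem_span_singleton_self b))
      (fun k _ => k.2)
    obtain ⟨x, rfl⟩ := Submodule.mem_span_singleton.mp hn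
    exact ⟨x, H⟩
  have hone : ∀ k : K, ∃ x : R, ∃ z ∈ N, k.1.1 • x • b - k.1.2.2 • b = k.1.2.1 • z := fun k =>
    (hfin {k}).imp fun x hx => hx k (Finset.mem_singleton_self k)
  choose ρ ζ hζ hρ using hone
  let L : K → Ideal R := fun k => (N.map (LinearMap.lsmul R M k.1.2.1)).comap
    ((LinearMap.lsmul R M k.1.1).comp (LinearMap.toSpanSingleton R M b))
  have hL : ∀ k x, x ∈ L k ↔ ∃ z ∈ N, k.1.2.1 • z = k.1.1 • x • b := fun k x => Iff.rfl
  obtain ⟨x, hx⟩ := hR' K L ρ (by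
      obtain ⟨a, ha, hab⟩ := hb
      refine fun hbot => ha ((Submodule.mem_bot R).mp (hbot ▸ ?_))
      -- The annihilator of `b` is contained in every `L k`.
      exact Submodule.mem_iInf _ |>.mpr fun k => (hL k a).mpr ⟨0, N.zero_mem, by simp [hab]⟩)
    (fun F => by
      obtain ⟨x, hx⟩ := hfin F
      refine ⟨x, fun k hk => ?_⟩
      obtain ⟨z, hz, e⟩ := hx k hk
      refine (hL k _).mpr ⟨z - ζ k, N.sub_mem hz (hζ k), ?_⟩
      linear_combination (norm := module) hρ k - e)
  refine ⟨x • b, N.smul_mem _ (Submodule.mem_span_singleton_self b), fun c hc r s y h => ?_⟩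
  obtain ⟨d, rfl⟩ := Submodule.mem_span_singleton.mp hc
  let k : K := ⟨(r, s, d), y, h⟩
  obtain ⟨z, hz, e⟩ := (hL k _).mp (hx k)
  have e' := hρ k
  refine ⟨z + ζ k, N.add_mem hz (hζ k), ?_⟩
  simp only [k] at e e' ⊢
  linear_combination (norm := module) e' - e

/-- Over an almost maximal Prüfer domain, relatively divisible cyclic torsion submodules are direct
summands. -/
theorem IsRelDivisible.exists_isCompl {b : M} (hR : IsPruferDomain R)
    (hR' : IsAlmostMaximal R) (hb : ∃ a : R, a ≠ 0 ∧ a • b = 0)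
    (hN : IsRelDivisible (Submodule.span R {b})) :
    ∃ K : Submodule R M, IsCompl (Submodule.span R {b}) K := by
  set N := Submodule.span R {b} with hNdef
  -- `K ∈ S` says that `N` meets `K` trivially (take `s = 0`) and has relatively divisible image in
  -- `M ⧸ K`.
  let S : Set (Submodule R M) := {K | ∀ c ∈ N, ∀ (s : R) (y : M), c - s • y ∈ K →
    ∃ n ∈ N, c = s • n}
  obtain ⟨K, hK⟩ : ∃ K, Maximal (· ∈ S) K := by
    refine zorn_le₀ S fun C hC hchain => ?_
    rcases C.eq_empty_or_nonempty with rfl | hne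
    · refine ⟨⊥, fun c hc s y h => hN c hc s y (sub_eq_zero.mp ((Submodule.mem_bot R).mp h)), ?_⟩
      simp
    · refine ⟨sSup C, fun c hc s y h => ?_, fun A hA => le_sSup hA⟩
      obtain ⟨A, hA, hmem⟩ := (Submodule.mem_sSup_of_directed hne hchain.directedOn).mp h
      exact hC hA c hc s y hmem
  have hKS : K ∈ S := hK.prop
  have hspan : ∀ x ∈ Submodule.span R {K.mkQ b}, ∃ n ∈ N, K.mkQ n = x := by
    intro x hx
    obtain ⟨a, rfl⟩ := Submodule.mem_span_singleton.mp hx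
    exact ⟨a • b, N.smul_mem _ (Submodule.mem_span_singleton_self b), map_smul _ _ _⟩
  have hspan' : ∀ n ∈ N, K.mkQ n ∈ Submodule.span R {K.mkQ b} := by
    intro x hx
    obtain ⟨a, rfl⟩ := Submodule.mem_span_singleton.mp hx
    exact Submodule.mem_span_singleton.mpr ⟨a, (map_smul _ _ _).symm⟩
  have hquot : IsRelDivisible (Submodule.span R {K.mkQ b}) := by
    intro x hx s y h
    obtain ⟨c, hc, rfl⟩ := hspan x hx
    obtain ⟨y, rfl⟩ := K.mkQ_surjective y
    obtain ⟨n, hn, rfl⟩ := hKS c hc s y (by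
      rw [← Submodule.ker_mkQ K, LinearMap.mem_ker, map_sub, map_smul, h, sub_self])
    exact ⟨K.mkQ n, hspan' n hn, map_smul _ _ _⟩
  refine ⟨K, ?_, ?_⟩
  · rw [Submodule.disjoint_def]
    intro x hx hxK
    obtain ⟨n, -, rfl⟩ := hKS x hx 0 0 (by simpa using hxK)
    exact zero_smul _ _
  · rw [codisjoint_iff_le_sup]
    rintro m -
    obtain ⟨n', hn', H⟩ := hquot.exists_solution_of_isAlmostMaximal hR hR' (by
      obtain ⟨a, ha, hab⟩ := hb
      exact ⟨a, ha, by rw [← map_smul, hab, map_zero]⟩) (K.mkQ m)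
    obtain ⟨n, hn, rfl⟩ := hspan n' hn'
    have hmem : K ⊔ Submodule.span R {m - n} ∈ S := by
      intro c hc s y h
      obtain ⟨k, hk, w, hw, e⟩ := Submodule.mem_sup.mp h
      obtain ⟨r, rfl⟩ := Submodule.mem_span_singleton.mp hw
      have hk0 : K.mkQ k = 0 := by rwa [← LinearMap.mem_ker, Submodule.ker_mkQ]
      have e' := congrArg K.mkQ e
      simp only [map_add, map_smul, map_sub, hk0, zero_add] at e'
      -- Modulo `K`, the relation reads `r • m - (c + r • n) = -s • y`; replacing `m` by `n` cancels
      -- `r • n` and leaves `c = s • z`.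
      obtain ⟨z', hz', e''⟩ := H (K.mkQ (c + r • n)) (hspan' _ (N.add_mem hc (N.smul_mem _ hn)))
        r (-s) (K.mkQ y) (by
          rw [map_add, map_smul]
          linear_combination (norm := module) e')
      obtain ⟨z, hz, rfl⟩ := hspan z' hz'
      refine hKS c hc s z ?_
      rw [← Submodule.ker_mkQ K, LinearMap.mem_ker, map_sub, map_smul]
      rw [map_add, map_smul] at e''
      linear_combination (norm := module) -e''
    have hle := hK.le_of_ge hmem le_sup_left
    have : m - n ∈ K := hle (Submodule.mem_sup_right (Submodule.mem_span_singleton_self _))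
    exact Submodule.mem_sup.mpr ⟨n, hn, m - n, this, by abel⟩

end Prufer

/-! ### Retracts, torsion and the two directions -/

section VirtuallyRegular

variable {R : Type u} [CommRing R] {M : Type v} [AddCommGroup M] [Module R M]

theorem exists_isCompl_of_comp_eq_id {N : Type*} [AddCommGroup N] [Module R N]
    (f : M →ₗ[R] N) (g : N →ₗ[R] M) (h : f ∘ₗ g = LinearMap.id) :
    ∃ B C : Submodule R M, IsCompl B C ∧ Nonempty (N ≃ₗ[R] B) := by
  have hfg : ∀ x, f (g x) = x := LinearMap.congr_fun h
  refine ⟨LinearMap.range g, LinearMap.ker f, ⟨?_, ?_⟩,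
    ⟨LinearEquiv.ofInjective g (Function.LeftInverse.injective hfg)⟩⟩
  · rw [Submodule.disjoint_def]
    rintro _ ⟨x, rfl⟩ hx
    rw [LinearMap.mem_ker, hfg] at hx
    rw [hx, map_zero]
  · rw [codisjoint_iff_le_sup]
    rintro x -
    exact Submodule.mem_sup.mpr ⟨g (f x), ⟨_, rfl⟩, x - g (f x), by simp [hfg], by abel⟩

theorem exists_comp_eq_id_of_isCompl {N : Type*} [AddCommGroup N] [Module R N]
    {B C : Submodule R M} (h : IsCompl B C) (e : N ≃ₗ[R] B) :
    ∃ (f : M →ₗ[R] N) (g : N →ₗ[R] M), f ∘ₗ g = LinearMap.id := by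
  refine ⟨e.symm.toLinearMap ∘ₗ B.projectionOnto C h, B.subtype ∘ₗ e.toLinearMap, ?_⟩
  ext x
  simp

/-- A module is virtually regular if and only if every cyclic submodule is a retract of it. -/
theorem isVirtuallyRegular_iff : IsVirtuallyRegular R M ↔ ∀ x : M,
    ∃ (f : M →ₗ[R] Submodule.span R {x}) (g : Submodule.span R {x} →ₗ[R] M),
      f ∘ₗ g = LinearMap.id := by
  refine ⟨fun h x => ?_, fun h N hN => ?_⟩
  · obtain ⟨B, C, hBC, ⟨e⟩⟩ := h (Submodule.span R {x}) ⟨x, rfl⟩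
    exact exists_comp_eq_id_of_isCompl hBC e
  · obtain ⟨x, rfl⟩ := hN.principal
    obtain ⟨f, g, hfg⟩ := h x
    exact exists_isCompl_of_comp_eq_id f g hfg

theorem exists_comp_eq_id_congr {N N' : Type*} [AddCommGroup N] [Module R N]
    [AddCommGroup N'] [Module R N'] (e : N ≃ₗ[R] N')
    (h : ∃ (f : M →ₗ[R] N) (g : N →ₗ[R] M), f ∘ₗ g = LinearMap.id) :
    ∃ (f : M →ₗ[R] N') (g : N' →ₗ[R] M), f ∘ₗ g = LinearMap.id := by
  obtain ⟨f, g, hfg⟩ := h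
  refine ⟨e.toLinearMap ∘ₗ f, g ∘ₗ e.symm.toLinearMap, ?_⟩
  ext x
  simpa using congrArg e (LinearMap.congr_fun hfg (e.symm x))

/-- A cyclic module generated by an element with zero annihilator is free of rank one. -/
theorem nonempty_equiv_span_singleton {x : M} (hx : ∀ a : R, a • x = 0 → a = 0) :
    Nonempty (R ≃ₗ[R] Submodule.span R {x}) := by
  have hinj : Function.Injective (LinearMap.toSpanSingleton R M x) :=
    (injective_iff_map_eq_zero _).mpr hx
  exact ⟨(LinearEquiv.ofInjective _ hinj).trans
    (LinearEquiv.ofEq _ _ (LinearMap.range_toSpanSingleton x))⟩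

theorem IsVirtuallyRegular.torsion (h : IsVirtuallyRegular R M) :
    IsVirtuallyRegular R (Submodule.torsion R M) := by
  rw [isVirtuallyRegular_iff] at h ⊢
  intro x
  let e : Submodule.span R {(x : M)} ≃ₗ[R] Submodule.span R {x} :=
    ((Submodule.equivMapOfInjective _ (Submodule.torsion R M).injective_subtype
      (Submodule.span R {x})).trans (LinearEquiv.ofEq _ _ (by
        rw [Submodule.map_span, Set.image_singleton]; rfl))).symm
  refine exists_comp_eq_id_congr e ?_
  obtain ⟨f, g, hfg⟩ := h x
  refine ⟨f ∘ₗ (Submodule.torsion R M).subtype, g.codRestrict _ fun y => ?_, ?_⟩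
  · obtain ⟨a, ha⟩ := Submodule.mem_torsion_iff (x : M) |>.mp x.2
    refine Submodule.mem_torsion_iff _ |>.mpr ⟨a, ?_⟩
    rw [Submonoid.smul_def] at ha ⊢
    obtain ⟨r, hr⟩ := Submodule.mem_span_singleton.mp y.2
    have : (a : R) • y = 0 := by
      apply Subtype.ext
      rw [Submodule.coe_smul, ← hr, smul_comm, ha, smul_zero, Submodule.coe_zero]
    rw [← map_smul, this, map_zero]
  · ext y
    simpa using congrArg Subtype.val (LinearMap.congr_fun hfg y)

variable [IsDomain R]

theorem smul_mk_torsion_eq_zero {x : M} (hx : x ∉ Submodule.torsion R M) (a : R)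
    (h : a • (Submodule.torsion R M).mkQ x = 0) : a = 0 := by
  by_contra ha
  rw [← map_smul, ← LinearMap.mem_ker, Submodule.ker_mkQ, Submodule.mem_torsion_iff] at h
  obtain ⟨c, hc⟩ := h
  refine hx (Submodule.mem_torsion_iff x |>.mpr
    ⟨c * ⟨a, mem_nonZeroDivisors_of_ne_zero ha⟩, ?_⟩)
  rw [Submonoid.smul_def] at hc ⊢
  simpa [mul_smul] using hc

theorem smul_eq_zero_of_notMem_torsion {x : M} (hx : x ∉ Submodule.torsion R M) (a : R)
    (h : a • x = 0) : a = 0 :=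
  smul_mk_torsion_eq_zero hx a (by rw [← map_smul, h, map_zero])

theorem IsVirtuallyRegular.quotient_torsion (h : IsVirtuallyRegular R M) :
    IsVirtuallyRegular R (M ⧸ Submodule.torsion R M) := by
  rw [isVirtuallyRegular_iff] at h ⊢
  intro x'
  obtain ⟨x, rfl⟩ := (Submodule.torsion R M).mkQ_surjective x'
  by_cases hx : x ∈ Submodule.torsion R M
  · have : (Submodule.torsion R M).mkQ x = 0 := by
      rwa [← LinearMap.mem_ker, Submodule.ker_mkQ]
    rw [this]
    refine ⟨0, 0, LinearMap.ext fun y => Subtype.ext ?_⟩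
    obtain ⟨a, ha⟩ := Submodule.mem_span_singleton.mp y.2
    simpa using ha
  · obtain ⟨e⟩ := nonempty_equiv_span_singleton (smul_eq_zero_of_notMem_torsion hx)
    obtain ⟨e'⟩ := nonempty_equiv_span_singleton (smul_mk_torsion_eq_zero hx)
    refine exists_comp_eq_id_congr e' ?_
    obtain ⟨f, g, hfg⟩ := exists_comp_eq_id_congr e.symm (h x)
    refine ⟨(Submodule.torsion R M).liftQ f fun y hy => ?_, (Submodule.torsion R M).mkQ ∘ₗ g, ?_⟩
    · obtain ⟨a, ha⟩ := Submodule.mem_torsion_iff y |>.mp hy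
      rw [Submonoid.smul_def] at ha
      have := congrArg f ha
      rw [map_smul, map_zero, smul_eq_mul] at this
      exact (mul_eq_zero.mp this).resolve_left (nonZeroDivisors.coe_ne_zero a)
    · ext
      simpa using LinearMap.congr_fun hfg 1

theorem exists_comp_eq_id_of_notMem_torsion
    (h : IsVirtuallyRegular R (M ⧸ Submodule.torsion R M)) {x : M}
    (hx : x ∉ Submodule.torsion R M) :
    ∃ (f : M →ₗ[R] Submodule.span R {x}) (g : Submodule.span R {x} →ₗ[R] M),
      f ∘ₗ g = LinearMap.id := by
  obtain ⟨e⟩ := nonempty_equiv_span_singleton (smul_eq_zero_of_notMem_torsion hx)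
  obtain ⟨e'⟩ := nonempty_equiv_span_singleton (smul_mk_torsion_eq_zero hx)
  refine exists_comp_eq_id_congr e ?_
  obtain ⟨f, g, hfg⟩ := exists_comp_eq_id_congr e'.symm
    (isVirtuallyRegular_iff.mp h ((Submodule.torsion R M).mkQ x))
  -- Since `R` is free, the section lifts to `M` through any preimage of `g 1`.
  obtain ⟨y, hy⟩ := (Submodule.torsion R M).mkQ_surjective (g 1)
  refine ⟨f ∘ₗ (Submodule.torsion R M).mkQ, LinearMap.toSpanSingleton R M y, ?_⟩
  ext
  rw [LinearMap.comp_apply, LinearMap.comp_apply, LinearMap.toSpanSingleton_apply, one_smul, hy]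
  exact LinearMap.congr_fun hfg 1

theorem exists_comp_eq_id_of_mem_torsion (hR : IsPruferDomain R) (hR' : IsAlmostMaximal R)
    (h : IsVirtuallyRegular R (Submodule.torsion R M)) {x : M}
    (hx : x ∈ Submodule.torsion R M) :
    ∃ (f : M →ₗ[R] Submodule.span R {x}) (g : Submodule.span R {x} →ₗ[R] M),
      f ∘ₗ g = LinearMap.id := by
  set T := Submodule.torsion R M with hT
  let e : Submodule.span R {(⟨x, hx⟩ : T)} ≃ₗ[R] Submodule.span R {x} :=
    (Submodule.equivMapOfInjective _ T.injective_subtype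
      (Submodule.span R {(⟨x, hx⟩ : T)})).trans (LinearEquiv.ofEq _ _ (by
        rw [Submodule.map_span, Set.image_singleton]; rfl))
  obtain ⟨f, g, hfg⟩ := exists_comp_eq_id_congr e (isVirtuallyRegular_iff.mp h ⟨x, hx⟩)
  have hfg' : ∀ y, f (g y) = y := LinearMap.congr_fun hfg
  let k : Submodule.span R {x} →ₗ[R] M := T.subtype ∘ₗ g
  have hk : Function.Injective k :=
    T.injective_subtype.comp (Function.LeftInverse.injective hfg')
  let b : M := k ⟨x, Submodule.mem_span_singleton_self x⟩
  have hrange : LinearMap.range k = Submodule.span R {b} := by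
    apply le_antisymm
    · rintro _ ⟨⟨y, hy⟩, rfl⟩
      obtain ⟨a, rfl⟩ := Submodule.mem_span_singleton.mp hy
      exact Submodule.mem_span_singleton.mpr ⟨a, by rw [← map_smul]; rfl⟩
    · rw [Submodule.span_singleton_le_iff_mem]
      exact ⟨_, rfl⟩
  have hdiv : IsRelDivisible (Submodule.span R {b}) := by
    rw [← hrange]
    rintro _ ⟨y, rfl⟩ s m hm
    by_cases hs : s = 0
    · exact ⟨0, zero_mem _, by rw [hm, hs, zero_smul, zero_smul]⟩
    have hmT : m ∈ T := by
      by_contra hmT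
      have hmem : s • m ∈ T := hm ▸ (g y).2
      refine hs (smul_mk_torsion_eq_zero hmT s ?_)
      rwa [← map_smul, ← LinearMap.mem_ker, Submodule.ker_mkQ]
    -- Applying the projection `k ∘ f` of `T` to `m` moves the divisor into the summand.
    refine ⟨k (f ⟨m, hmT⟩), ⟨_, rfl⟩, ?_⟩
    have hgy : g y = s • ⟨m, hmT⟩ := Subtype.ext hm
    rw [← map_smul, ← map_smul, ← hgy, hfg']
  obtain ⟨K, hK⟩ := hdiv.exists_isCompl hR hR' (by
    obtain ⟨a, ha⟩ := Submodule.mem_torsion_iff b |>.mp (g _).2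
    exact ⟨a, nonZeroDivisors.coe_ne_zero a, ha⟩)
  rw [← hrange] at hK
  exact exists_comp_eq_id_of_isCompl hK (LinearEquiv.ofInjective k hk)

end VirtuallyRegular

theorem mainTheorem5 (R : Type u) [CommRing R] [IsDomain R]
    (M : Type v) [AddCommGroup M] [Module R M] :
    (IsVirtuallyRegular R M →
      IsVirtuallyRegular R (Submodule.torsion R M) ∧
        IsVirtuallyRegular R (M ⧸ Submodule.torsion R M)) ∧
    (IsPruferDomain R → IsAlmostMaximal R →
      IsVirtuallyRegular R (Submodule.torsion R M) →
      IsVirtuallyRegular R (M ⧸ Submodule.torsion R M) →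
      IsVirtuallyRegular R M) := by
  refine ⟨fun h => ⟨h.torsion, h.quotient_torsion⟩, fun hR hR' hT hQ => ?_⟩
  refine isVirtuallyRegular_iff.mpr fun x => ?_
  by_cases hx : x ∈ Submodule.torsion R M
  · exact exists_comp_eq_id_of_mem_torsion hR hR' hT hx
  · exact exists_comp_eq_id_of_notMem_torsion hQ hx
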